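/- **Definitions.** Let $\mathbb{N}=\{0,1,2,\dots\}$. A function $f:\mathbb{N}\to\mathbb{Z}$ is an *integer-valued quasi-polynomial* if there are an integer $T\ge 1$ and polynomials $f_0,\dots,f_{T-1}\in\mathbb{Z}[x]$ (its constituents) with $f(Tm+i)=f_i(m)$ for all $m\in\mathbb{N}$ and $0\le i<T$; let $R$ be the ring of these functions. Write $f\succcurlyeq 0$ if each $f_i$ is zero or has positive leading coefficient, and $f\succ 0$ if each $f_i$ has positive leading coefficient; $f\prec g$ means $g-f\succ 0$. For $g\in\mathbb{Z}[x]$, $g\neq 0$, let $|g|$ be the one of $\pm g$ with positive leading coefficient. For $f,g\in\mathbb{Z}[x]$ with $g\ne0$, $\mathrm{rem}(f,g)$ is the unique $r\in R$ with $0\preccurlyeq r\prec|g|$ and $f=Pg+r$ for some $P\in R$. For $f,g\in R$ with constituents $f_i,g_i$ with respect to a common period $T$, $\mathrm{rem}(f,g)\in R$ is the function $r$ with $r(Tm+i)=\mathrm{rem}(f_i,g_i)(m)$ if $g_i\neq0$ and $r(Tm+i)=f_i(m)$ if $g_i=0$. For $f,g\in R$ with $g(n)\neq0$ for all $n\in\mathbb{N}$,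 $g$ is a *divisor* of $f$ if $g(n)\mid f(n)$ for all $n\in\mathbb{N}$. Two elements of $R$ are *coprime* if $1$ is a greatest common divisor of them in $R$, that is, each of their common divisors in $R$ is a divisor of $1$. A vector over $R$ is *pairwise coprime* if any two entries with different indices are coprime; it is *constant* if each of its nonzero entries has a representation all of whose constituents are constants. For $A=(a_1,\dots,a_s)\in R^s$ and indices $i_1,\dots,i_k\in\{1,\dots,s\}$ define vectors $A_{i_1\cdots i_k}=(a_{i_1\cdots i_k1},\dots,a_{i_1\cdots i_ks})$ recursively, starting from $A$ itself for $k=0$, by $$a_{i_1\cdots i_ki_{k+1}i}=\begin{cases}\mathrm{rem}(a_{i_1\cdots i_ki},\,a_{i_1\cdots i_ki_{k+1}}),& i\neq i_{k+1},\\ a_{i_1\cdots i_ki_{k+1}},& i=i_{k+1}.\end{cases}$$ $A$ is *strongly coprime* if $A$ is pairwise coprime and, for all $k\ge1$, every vector $A_{i_1\cdots i_k}$ that is not constant is pairwise coprime. **Theorem.** Let $m(n)$ and $a_1(n),\dots,a_s(n)$ be polynomials with rational coefficients that take integer values on $\mathbb{N}$ and have positive leading coefficients, and suppose that $A(n)=(a_1(n),\dots,a_s(n))$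 is strongly coprime. Then there are an integer-valued quasi-polynomial $f$ and an $N\in\mathbb{N}$ such that for every integer $n\ge N$ the number of $s$-tuples $(x_1,\dots,x_s)$ of nonnegative integers with $a_1(n)x_1+\cdots+a_s(n)x_s=m(n)$ is finite and equal to $f(n)$. -/

import Mathlib

namespace QuasiPoly

open Polynomial

/-- `(T, {p_i})` represents `f : ℕ → ℤ`: `f (T m + i) = p_i (m)` for `0 ≤ i < T` and all `m`. -/
def IsRepresentation (T : ℕ) (p : Fin T → ℤ[X]) (f : ℕ → ℤ) : Prop :=
  0 < T ∧ ∀ (i : Fin T) (m : ℕ), f (T * m + i) = (p i).eval (m : ℤ)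

/-- Integer-valued quasi-polynomials. -/
def IsQuasiPoly (f : ℕ → ℤ) : Prop :=
  ∃ (T : ℕ) (p : Fin T → ℤ[X]), IsRepresentation T p f

/-- `f ≽ 0`: every constituent is zero or has positive leading coefficient. -/
def Nonneg (f : ℕ → ℤ) : Prop :=
  ∃ (T : ℕ) (p : Fin T → ℤ[X]), IsRepresentation T p f ∧
    ∀ i, p i = 0 ∨ 0 < (p i).leadingCoeff

/-- `f ≻ 0`: every constituent has positive leading coefficient. -/
def StrictlyPositive (f : ℕ → ℤ) : Prop :=
  ∃ (T : ℕ) (p : Fin T → ℤ[X]), IsRepresentation T p f ∧ ∀ i, 0 < (p i).leadingCoeff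

/-- The absolute value of an integer polynomial: `±g`, with nonnegative leading coefficient. -/
noncomputable def polyAbs (g : ℤ[X]) : ℤ[X] :=
  if 0 ≤ g.leadingCoeff then g else -g

/-- `r = rem(f, g)` for `f, g ∈ ℤ[x]`, `g ≠ 0`: `r` is a quasi-polynomial, `f = P g + r` for
some quasi-polynomial `P`, and `0 ≼ r ≺ |g|`. -/
def IsPolyRem (f g : ℤ[X]) (r : ℕ → ℤ) : Prop :=
  IsQuasiPoly r ∧
  (∃ P : ℕ → ℤ, IsQuasiPoly P ∧
    ∀ n : ℕ, f.eval (n : ℤ) = P n * g.eval (n : ℤ) + r n) ∧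
  Nonneg r ∧ StrictlyPositive (fun n => (polyAbs g).eval (n : ℤ) - r n)

/-- `r = rem(f, g)` for quasi-polynomials `f, g`: on each residue class of a common period,
`r` is the remainder of the constituents where that of `g` is nonzero, and equals `f` where
that of `g` is zero. -/
def IsRem (f g r : ℕ → ℤ) : Prop :=
  ∃ (T : ℕ) (p q : Fin T → ℤ[X]), IsRepresentation T p f ∧ IsRepresentation T q g ∧
    ∀ i : Fin T,
      (q i ≠ 0 → IsPolyRem (p i) (q i) (fun m => r (T * m + i))) ∧
      (q i = 0 → ∀ m : ℕ, r (T * m + i) = (p i).eval (m : ℤ))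

/-- `g` is a divisor of `f`; divisors are required to vanish nowhere. -/
def IsDivisor (g f : ℕ → ℤ) : Prop :=
  (∀ n, g n ≠ 0) ∧ ∀ n, g n ∣ f n

def IsCommonDivisor {ι : Type} (f : ι → ℕ → ℤ) (d : ℕ → ℤ) : Prop :=
  IsQuasiPoly d ∧ ∀ i, IsDivisor d (f i)

/-- `d = ggcd(f_i)`: the greatest common divisor in the ring of quasi-polynomials that is
normalized by `d ≽ 0`. -/
def IsGGCD {ι : Type} (f : ι → ℕ → ℤ) (d : ℕ → ℤ) : Prop :=
  IsCommonDivisor f d ∧ (∀ e, IsCommonDivisor f e → IsDivisor e d) ∧ Nonneg d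

/-- The entries of the vector are pairwise coprime: `ggcd(B_i, B_j) = 1` for `i ≠ j`. -/
def PairwiseCoprime {s : ℕ} (B : Fin s → ℕ → ℤ) : Prop :=
  ∀ i j, i ≠ j → IsGGCD ![B i, B j] 1

/-- Every nonzero entry of the vector has degree zero. -/
def IsConstantVector {s : ℕ} (B : Fin s → ℕ → ℤ) : Prop :=
  ∀ i, B i ≠ 0 → ∃ (T : ℕ) (p : Fin T → ℤ[X]), IsRepresentation T p (B i) ∧
    ∀ k, (p k).natDegree = 0

/-- `C` arises from `B` by keeping entry `j` and replacing every other entry by its remainder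
modulo entry `j`. -/
def RemStep {s : ℕ} (B : Fin s → ℕ → ℤ) (j : Fin s) (C : Fin s → ℕ → ℤ) : Prop :=
  C j = B j ∧ ∀ i, i ≠ j → IsRem (B i) (B j) (C i)

/-- All vectors `A_{i₁ ⋯ i_k}`. -/
def remVectors {s : ℕ} (A : Fin s → ℕ → ℤ) : ℕ → Set (Fin s → ℕ → ℤ)
  | 0 => {A}
  | k + 1 => {C | ∃ B ∈ remVectors A k, ∃ j, RemStep B j C}

/-- The set `A^(k)`: the vector `A` itself for `k = 0`, and the nonconstant vectors among the
`A_{i₁ ⋯ i_k}` for `k ≥ 1`. -/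
def level {s : ℕ} (A : Fin s → ℕ → ℤ) (k : ℕ) : Set (Fin s → ℕ → ℤ) :=
  {B | B ∈ remVectors A k ∧ (k = 0 ∨ ¬ IsConstantVector B)}

/-- All members of all the sets `A^(k)` are pairwise coprime. -/
def StronglyCoprime {s : ℕ} (A : Fin s → ℕ → ℤ) : Prop :=
  ∀ k, ∀ B ∈ level A k, PairwiseCoprime B

/-- `f` is (the value function of) an integer-valued polynomial, with rational coefficients,
whose leading coefficient is positive. -/
def IsPosIntValuedPoly (f : ℕ → ℤ) : Prop :=
  ∃ p : ℚ[X], 0 < p.leadingCoeff ∧ ∀ n : ℕ, (f n : ℚ) = p.eval (n : ℚ)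

/-- The nonnegative integer solutions `x` of `∑ a_i x_i = m`. -/
def solutions {s : ℕ} (a : Fin s → ℤ) (m : ℤ) : Set (Fin s → ℕ) :=
  {x | ∑ i, a i * (x i : ℤ) = m}

end QuasiPoly

/-! On each residue class of a suitable period the data are, for large `n`, integer polynomials.
Then `a_i(n) ≥ 1`, so `x_i ≤ m(n) < n^K` with `K = deg m + 1`, and `x_i` is encoded by `K` digits in
base `n`. The equation says that a polynomial in `n`, with coefficients affine in the digits,
vanishes. Reading it from the lowest power, each coefficient plus the incoming carry is `n` times an
outgoing carry, which is bounded independently of `n`. Hence there are finitely many carry patterns,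
each amounting to linear equations `α · x = u n + w` on the box `[0, n)^ι`
(`eventuallyQuasiPoly_carry`).

With slack variables, such points form the degree `n` part of a set `S` stable under the monoid `H`
of homogeneous solutions. Well-quasi-ordering makes `H` finitely generated and `S` a finite union of
translates `e_i + H`. Keeping the lexicographically least representation of each point reduces the
count to lower sets of `ℕ^k` graded by weighted degree (`eventuallyQuasiPoly_of_subtractive`), as
one counts standard monomials for a Hilbert function. Slicing off a coordinate hyperplane then gives
a recurrence that is solved by summation (`eventuallyQuasiPoly_lowerSet_of_support`). -/

namespace QuasiPoly

open Polynomial Filter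

/-! ### Eventually polynomial and eventually quasi-polynomial functions -/

/-- `g` agrees with a rational polynomial for all large arguments. -/
def EventuallyPoly (g : ℕ → ℤ) : Prop :=
  ∃ p : ℚ[X], ∀ᶠ n : ℕ in atTop, (g n : ℚ) = p.eval (n : ℚ)

/-- `f` agrees, on each residue class of some period, with a rational polynomial for all large
arguments. -/
def EventuallyQuasiPoly (f : ℕ → ℤ) : Prop :=
  ∃ T : ℕ, 0 < T ∧ ∀ i, EventuallyPoly fun m => f (T * m + i)

theorem tendsto_mul_add {T : ℕ} (hT : 0 < T) (i : ℕ) :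
    Tendsto (fun m : ℕ => T * m + i) atTop atTop :=
  tendsto_atTop_mono (fun m => (Nat.le_mul_of_pos_left m hT).trans (Nat.le_add_right _ i))
    tendsto_id

namespace EventuallyPoly

variable {f g : ℕ → ℤ}

theorem congr (hf : EventuallyPoly f) (h : f =ᶠ[atTop] g) : EventuallyPoly g := by
  obtain ⟨p, hp⟩ := hf
  refine ⟨p, ?_⟩
  filter_upwards [hp, h] with n h1 h2
  rw [← h2, h1]

theorem const (c : ℤ) : EventuallyPoly fun _ => c :=
  ⟨C (c : ℚ), Eventually.of_forall fun n => by simp⟩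

theorem add (hf : EventuallyPoly f) (hg : EventuallyPoly g) :
    EventuallyPoly fun n => f n + g n := by
  obtain ⟨p, hp⟩ := hf
  obtain ⟨q, hq⟩ := hg
  refine ⟨p + q, ?_⟩
  filter_upwards [hp, hq] with n h1 h2
  simp [h1, h2]

theorem comp_affine (hf : EventuallyPoly f) {a : ℕ} (ha : 0 < a) (b : ℕ) :
    EventuallyPoly fun n => f (a * n + b) := by
  obtain ⟨p, hp⟩ := hf
  refine ⟨p.comp (C (a : ℚ) * X + C (b : ℚ)), ?_⟩
  filter_upwards [(tendsto_mul_add ha b).eventually hp] with n hn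
  simp [hn]

theorem of_shift {d : ℕ} (hf : EventuallyPoly fun n => f (n + d)) : EventuallyPoly f := by
  obtain ⟨p, hp⟩ := hf
  refine ⟨p.comp (X - C (d : ℚ)), ?_⟩
  filter_upwards [(tendsto_sub_atTop_nat d).eventually hp, eventually_ge_atTop d] with n hn hd
  rw [Nat.sub_add_cancel hd] at hn
  simp [hn, Nat.cast_sub hd]

end EventuallyPoly

/-- The partial sums of a polynomial are given by a polynomial. -/
theorem exists_polynomial_sum_range (p : ℚ[X]) :
    ∃ q : ℚ[X], ∀ n : ℕ, ∑ k ∈ Finset.range n, p.eval (k : ℚ) = q.eval (n : ℚ) := by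
  induction p using Polynomial.induction_on' with
  | add p q hp hq =>
    obtain ⟨p', hp'⟩ := hp
    obtain ⟨q', hq'⟩ := hq
    exact ⟨p' + q', fun n => by simp [Finset.sum_add_distrib, hp', hq']⟩
  | monomial k c =>
    refine ⟨C c * ∑ i ∈ Finset.range (k + 1),
      C (_root_.bernoulli i * ((k + 1).choose i) / (k + 1)) * X ^ (k + 1 - i), fun n => ?_⟩
    simp only [eval_monomial, ← Finset.mul_sum, sum_range_pow, eval_mul, eval_C, eval_finsetSum,
      eval_pow, eval_X]
    congr 1
    refine Finset.sum_congr rfl fun i _ => ?_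
    ring

theorem EventuallyPoly.of_recurrence {f g : ℕ → ℤ} (hg : EventuallyPoly g)
    (h : ∀ᶠ n in atTop, f (n + 1) = f n + g n) : EventuallyPoly f := by
  obtain ⟨p, hp⟩ := hg
  obtain ⟨N, hN⟩ := eventually_atTop.1 (hp.and h)
  obtain ⟨q, hq⟩ := exists_polynomial_sum_range (p.comp (X + C (N : ℚ)))
  refine .of_shift (d := N) ⟨C (f N : ℚ) + q, Eventually.of_forall fun n => ?_⟩
  rw [eval_add, ← hq, eval_C]
  induction n with
  | zero => simp
  | succ n ih =>
    have h1 := hN (n + N) (by omega)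
    dsimp only at ih ⊢
    rw [add_right_comm, h1.2, Finset.sum_range_succ, Int.cast_add, ih, h1.1]
    simp [add_assoc]

namespace EventuallyQuasiPoly

variable {f g : ℕ → ℤ}

theorem congr (hf : EventuallyQuasiPoly f) (h : f =ᶠ[atTop] g) : EventuallyQuasiPoly g := by
  obtain ⟨T, hT, hf⟩ := hf
  exact ⟨T, hT, fun i => (hf i).congr ((tendsto_mul_add hT i).eventually h)⟩

theorem const (c : ℤ) : EventuallyQuasiPoly fun _ => c :=
  ⟨1, one_pos, fun _ => .const c⟩

theorem mul_period {T k : ℕ} (hk : 0 < k) (h : ∀ i, EventuallyPoly fun m => f (T * m + i)) (i : ℕ) :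
    EventuallyPoly fun m => f (T * k * m + i) := by
  simpa [mul_assoc] using (h i).comp_affine hk 0

theorem add (hf : EventuallyQuasiPoly f) (hg : EventuallyQuasiPoly g) :
    EventuallyQuasiPoly fun n => f n + g n := by
  obtain ⟨T, hT, hf⟩ := hf
  obtain ⟨U, hU, hg⟩ := hg
  refine ⟨T * U, Nat.mul_pos hT hU, fun i => (mul_period hU hf i).add ?_⟩
  rw [mul_comm T U]
  exact mul_period hT hg i

theorem sum {κ : Type*} (s : Finset κ) {F : κ → ℕ → ℤ}
    (h : ∀ k ∈ s, EventuallyQuasiPoly (F k)) :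
    EventuallyQuasiPoly fun n => ∑ k ∈ s, F k n := by
  classical
  induction s using Finset.induction_on with
  | empty => simpa using const 0
  | insert a s ha ih =>
    simp only [Finset.sum_insert ha]
    exact (h a (by simp)).add (ih fun k hk => h k (by simp [hk]))

theorem shift (hf : EventuallyQuasiPoly f) (d : ℕ) : EventuallyQuasiPoly fun n => f (n + d) := by
  obtain ⟨T, hT, hf⟩ := hf
  exact ⟨T, hT, fun i => by simpa [add_assoc] using hf (i + d)⟩

theorem of_shift {d : ℕ} (hf : EventuallyQuasiPoly fun n => f (n + d)) :
    EventuallyQuasiPoly f := by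
  obtain ⟨T, hT, hf⟩ := hf
  refine ⟨T, hT, fun i => .of_shift (d := d) ?_⟩
  -- The total shift `i + (T - 1) d + d = i + T d` replaces `m` by `m + d` within the class of `i`.
  convert hf (i + (T - 1) * d) using 3 with m
  obtain ⟨t, rfl⟩ := Nat.exists_eq_add_of_lt hT
  simp only [zero_add, Nat.add_sub_cancel]
  ring

theorem of_recurrence {w : ℕ} (hw : 0 < w) (hg : EventuallyQuasiPoly g)
    (h : ∀ n, f (n + w) = f n + g n) : EventuallyQuasiPoly f := by
  obtain ⟨T, hT, hg⟩ := hg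
  have h1 : ∀ k n, f (n + w * k) = f n + ∑ j ∈ Finset.range k, g (n + w * j) := by
    intro k n
    induction k with
    | zero => simp
    | succ k ih => rw [Finset.sum_range_succ, ← add_assoc, ← ih, ← h, mul_add_one, add_assoc]
  -- `T` steps of length `w` preserve the class mod `T w`, and along it each of the `T` increments
  -- is eventually polynomial.
  refine ⟨T * w, Nat.mul_pos hT hw, fun i => ?_⟩
  refine EventuallyPoly.of_recurrence
    (g := fun m => ∑ j ∈ Finset.range T, g (T * w * m + i + w * j)) ?_ ?_
  · have : ∀ s : Finset ℕ, EventuallyPoly fun m => ∑ j ∈ s, g (T * w * m + i + w * j) := by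
      intro s
      induction s using Finset.induction_on with
      | empty => simpa using EventuallyPoly.const 0
      | insert a s ha ih =>
        simp only [Finset.sum_insert ha]
        refine EventuallyPoly.add ?_ ih
        simpa [add_assoc] using mul_period hw hg (i + w * a)
    exact this _
  · refine Eventually.of_forall fun m => ?_
    rw [← h1]
    congr 1
    ring

theorem of_residues {D : ℕ} (hD : 0 < D) (h : ∀ j, EventuallyQuasiPoly fun n => f (D * n + j)) :
    EventuallyQuasiPoly f := by
  choose T hT h using h
  have key : ∀ k, ∃ U, 0 < U ∧ ∀ j < k, ∀ i, EventuallyPoly fun m => f (D * (U * m + i) + j) := by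
    intro k
    induction k with
    | zero => exact ⟨1, one_pos, by simp⟩
    | succ k ih =>
      obtain ⟨U, hU, ih⟩ := ih
      refine ⟨U * T k, Nat.mul_pos hU (hT k), fun j hj i => ?_⟩
      rcases Nat.lt_succ_iff_lt_or_eq.1 hj with hj | rfl
      · exact mul_period (f := fun n => f (D * n + j)) (hT k) (ih j hj) i
      · rw [mul_comm U]
        exact mul_period (f := fun n => f (D * n + j)) hU (h j) i
  obtain ⟨U, hU, hk⟩ := key D
  refine ⟨D * U, Nat.mul_pos hD hU, fun i => ?_⟩
  convert hk (i % D) (Nat.mod_lt _ hD) (i / D) using 3 with m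
  conv_lhs => rw [← Nat.div_add_mod i D]
  ring

end EventuallyQuasiPoly

/-! ### Integer constituents -/

/-- A rational polynomial that is integral at all large integers becomes an integer polynomial on
each residue class of a suitable period. -/
theorem EventuallyPoly.exists_period {g : ℕ → ℤ} (hg : EventuallyPoly g) :
    ∃ D : ℕ, 0 < D ∧ ∀ j, ∃ R : ℤ[X], ∀ᶠ m : ℕ in atTop, g (D * m + j) = R.eval (m : ℤ) := by
  obtain ⟨p, hp⟩ := hg
  obtain ⟨b, hb, hq⟩ := IsLocalization.integerNormalization_spec (nonZeroDivisors ℤ) p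
  set q := IsLocalization.integerNormalization (nonZeroDivisors ℤ) p
  have hb0 : b ≠ 0 := nonZeroDivisors.ne_zero hb
  have hqe : ∀ n : ℤ, ((q.eval n : ℤ) : ℚ) = b * p.eval (n : ℚ) := by
    intro n
    have := congrArg (eval (n : ℚ)) hq
    rw [eval_smul, eval_map_algebraMap] at this
    rw [← zsmul_eq_mul, ← this, ← eq_intCast (algebraMap ℤ ℚ) n, aeval_algebraMap_apply]
    simp
  have hg : ∀ᶠ n : ℕ in atTop, q.eval (n : ℤ) = b * g n := by
    filter_upwards [hp] with n hn
    have := hqe n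
    rw [Int.cast_natCast, ← hn] at this
    exact_mod_cast this
  refine ⟨b.natAbs, Int.natAbs_pos.2 hb0, fun j => ?_⟩
  have ht := tendsto_mul_add (Int.natAbs_pos.2 hb0) j
  -- `q(|b| X + j) - q(j)` is divisible by `|b| X`, hence by `b`.
  have hdvd : C b ∣ q.comp (C (b.natAbs : ℤ) * X + C (j : ℤ)) - C (q.eval (j : ℤ)) := by
    have h1 : (C (b.natAbs : ℤ) * X + C (j : ℤ)) - C (j : ℤ) ∣
        q.comp (C (b.natAbs : ℤ) * X + C (j : ℤ)) - C (q.eval (j : ℤ)) := by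
      have h2 := Polynomial.sub_dvd_eval_sub (C (b.natAbs : ℤ) * X + C (j : ℤ)) (C (j : ℤ))
        (q.map C)
      rwa [eval_map, eval_map, ← comp, eval₂_at_apply] at h2
    rw [add_sub_cancel_right] at h1
    exact ((C_dvd_iff_dvd_coeff _ _).2 fun i => by
      rw [coeff_C]; split_ifs <;> simp).trans ((Dvd.intro _ rfl).trans h1)
  -- One large argument in the class suffices: there `q = b g` with `g` integral, and `q` is
  -- constant mod `b` on the class.
  have hj : b ∣ q.eval (j : ℤ) := by
    obtain ⟨m, hm⟩ := (ht.eventually hg).exists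
    have h1 : b ∣ q.eval ((b.natAbs * m + j : ℕ) : ℤ) - q.eval (j : ℤ) := by
      refine dvd_trans ?_ (Polynomial.sub_dvd_eval_sub _ _ q)
      push_cast
      rw [add_sub_cancel_right]
      exact Dvd.dvd.mul_right ((dvd_abs _ _).2 dvd_rfl) _
    have h2 := dvd_sub (Dvd.intro _ hm.symm) h1
    rwa [sub_sub_cancel] at h2
  have hall : C b ∣ q.comp (C (b.natAbs : ℤ) * X + C (j : ℤ)) := by
    have := dvd_add hdvd (map_dvd C hj)
    rwa [sub_add_cancel] at this
  obtain ⟨R, hR⟩ := hall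
  refine ⟨R, ?_⟩
  filter_upwards [ht.eventually hg] with m hm
  have h1 := congrArg (eval (m : ℤ)) hR
  rw [eval_comp, eval_mul, eval_C] at h1
  apply mul_left_cancel₀ hb0
  rw [← hm, ← h1]
  simp

theorem exists_common_period {κ : Type*} [Fintype κ] {g : κ → ℕ → ℤ}
    (hg : ∀ k, EventuallyPoly (g k)) :
    ∃ D : ℕ, 0 < D ∧ ∀ k j, ∃ R : ℤ[X], ∀ᶠ m : ℕ in atTop, g k (D * m + j) = R.eval (m : ℤ) := by
  choose D hD h using fun k => (hg k).exists_period
  refine ⟨∏ k, D k, Finset.prod_pos fun k _ => hD k, fun k j => ?_⟩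
  obtain ⟨B, hB⟩ := Finset.dvd_prod_of_mem D (Finset.mem_univ k)
  have hB0 : 0 < B := Nat.pos_of_mul_pos_left (hB ▸ Finset.prod_pos fun k _ => hD k)
  obtain ⟨R, hR⟩ := h k j
  refine ⟨R.comp (C (B : ℤ) * X), ?_⟩
  filter_upwards [(tendsto_mul_add hB0 0).eventually hR] with m hm
  rw [hB]
  simpa [mul_assoc] using hm

theorem EventuallyQuasiPoly.exists_isQuasiPoly {f : ℕ → ℤ} (hf : EventuallyQuasiPoly f) :
    ∃ g : ℕ → ℤ, IsQuasiPoly g ∧ f =ᶠ[atTop] g := by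
  obtain ⟨T, hT, hf⟩ := hf
  obtain ⟨U, hU, hk⟩ := exists_common_period fun i : Fin T => hf i
  have hTU : 0 < T * U := Nat.mul_pos hT hU
  have hk' : ∀ i, ∃ R : ℤ[X], ∀ᶠ m : ℕ in atTop, f (T * U * m + i) = R.eval (m : ℤ) := by
    intro i
    obtain ⟨R, hR⟩ := hk ⟨i % T, Nat.mod_lt _ hT⟩ (i / T)
    refine ⟨R, ?_⟩
    filter_upwards [hR] with m hm
    rw [← hm]
    conv_lhs => rw [← Nat.div_add_mod i T]
    congr 1
    ring
  choose R hR using hk'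
  refine ⟨fun n => (R (n % (T * U))).eval ((n / (T * U) : ℕ) : ℤ),
    ⟨T * U, fun i => R i, hTU, fun i m => ?_⟩, ?_⟩
  · simp [Nat.mod_eq_of_lt i.2, Nat.mul_add_div hTU, Nat.div_eq_of_lt i.2]
  · have h1 : ∀ᶠ m : ℕ in atTop, ∀ i ∈ Finset.range (T * U),
        f (T * U * m + i) = (R i).eval (m : ℤ) :=
      (eventually_all_finset _).2 fun i _ => hR i
    filter_upwards [(Nat.tendsto_div_const_atTop hTU.ne').eventually h1] with n hn
    rw [← hn _ (Finset.mem_range.2 (Nat.mod_lt _ hTU)), Nat.div_add_mod]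

/-! ### Weighted counting in lower sets -/

/-- Lower sets of a well-quasi-order satisfy the descending chain condition. -/
theorem wellFoundedLT_lowerSet (α : Type*) [Preorder α] [WellQuasiOrderedLE α] :
    WellFoundedLT (LowerSet α) := by
  refine ⟨RelEmbedding.wellFounded_iff_isEmpty.2 ⟨fun F => ?_⟩⟩
  have hF : StrictAnti F := fun m n hmn => F.map_rel_iff.2 hmn
  -- If `y m ≤ y n` with `m < n`, then `y n ∈ F (m + 1)` forces `y m ∈ F (m + 1)`, a contradiction.
  have hex : ∀ n, ∃ y, y ∈ F n ∧ y ∉ F (n + 1) := fun n =>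
    Set.exists_of_ssubset (LowerSet.coe_ssubset_coe.2 (hF (Nat.lt_succ_self n)))
  choose y hy hy' using hex
  obtain ⟨m, n, hmn, hle⟩ := wellQuasiOrdered_le y
  exact hy' m ((F (m + 1)).lower hle (hF.antitone hmn (hy n)))

theorem ncard_eq_sum_ncard_fiber {α κ : Type*} {X : Set α} (hX : X.Finite) (c : α → κ)
    (t : Finset κ) (hc : ∀ x ∈ X, c x ∈ t) :
    X.ncard = ∑ k ∈ t, {x | x ∈ X ∧ c x = k}.ncard := by
  classical
  rw [Set.ncard_eq_toFinset_card X hX,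
    Finset.card_eq_sum_card_fiberwise (f := c) (t := t) (fun x hx => hc x (by simpa using hx))]
  refine Finset.sum_congr rfl fun k _ => ?_
  rw [← Set.ncard_coe_finset]
  congr 1
  ext x
  simp

section LowerSet

variable {ι : Type*} [DecidableEq ι] (deg : (ι → ℕ) →+ ℕ)

theorem apply_le_of_degree_single_pos {i : ι} (hi : 0 < deg (Pi.single i 1)) (y : ι → ℕ) :
    y i ≤ deg y := by
  have h : y = y i • Pi.single i 1 + Function.update y i 0 := by
    ext j
    by_cases hj : j = i
    · subst hj; simp
    · simp [hj]
  calc y i ≤ y i * deg (Pi.single i 1) := Nat.le_mul_of_pos_right _ hi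
    _ ≤ deg y := by
      conv_rhs => rw [h, map_add, map_nsmul, smul_eq_mul]
      exact Nat.le_add_right _ _

theorem finite_setOf_degree_eq [Finite ι] (D : LowerSet (ι → ℕ))
    (hD : ∀ y ∈ D, ∀ i, deg (Pi.single i 1) = 0 → y i = 0) (n : ℕ) :
    {y | y ∈ D ∧ deg y = n}.Finite := by
  refine (Set.Finite.pi' fun _ : ι => Set.finite_Iic n).subset ?_
  rintro y ⟨hy, rfl⟩ i
  rcases Nat.eq_zero_or_pos (deg (Pi.single i 1)) with h | h
  · simp [hD y hy i h]
  · exact apply_le_of_degree_single_pos deg h y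

/-- The number of elements of given weighted degree of a lower set of `ι → ℕ` is eventually
quasi-polynomial. -/
theorem eventuallyQuasiPoly_lowerSet_of_support [Finite ι] (t : Finset ι)
    (ht : ∀ i ∈ t, 0 < deg (Pi.single i 1)) (D : LowerSet (ι → ℕ))
    (hD : ∀ y ∈ D, ∀ i ∉ t, y i = 0) :
    EventuallyQuasiPoly fun n => ({y | y ∈ D ∧ deg y = n}.ncard : ℤ) := by
  have := wellFoundedLT_lowerSet (ι → ℕ)
  induction t using Finset.induction_on generalizing D with
  | empty =>
    refine (EventuallyQuasiPoly.const 0).congr ?_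
    filter_upwards [eventually_gt_atTop 0] with n hn
    have : {y | y ∈ D ∧ deg y = n} = ∅ := by
      ext y
      simp only [Set.mem_ofPred_eq, Set.mem_empty_iff_false, iff_false, not_and]
      rintro hy rfl
      have : y = 0 := funext fun i => hD y hy i (by simp)
      simp [this] at hn
    simp [this]
  | insert i t hi ih =>
    have hw : 0 < deg (Pi.single i 1) := ht i (by simp)
    have hsupp : ∀ E : LowerSet (ι → ℕ), (∀ y ∈ E, ∀ j ∉ insert i t, y j = 0) →
        ∀ y ∈ E, ∀ j, deg (Pi.single j 1) = 0 → y j = 0 := fun E hE y hy j hj =>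
      hE y hy j fun hjt => (ht j hjt).ne' hj
    induction D using WellFoundedLT.induction with
    | ind D ihD =>
    -- Elements of `D` with `y i > 0` are `D₁` translated by the `i`-th unit vector; the others form
    -- `D₀`, supported on `t`.
    let D₁ : LowerSet (ι → ℕ) := ⟨{y | y + Pi.single i 1 ∈ D}, fun a b hab ha =>
      D.lower (add_le_add_left hab _) ha⟩
    let D₀ : LowerSet (ι → ℕ) := ⟨{y | y ∈ D ∧ y i = 0}, fun a b hab ha =>
      ⟨D.lower hab ha.1, Nat.le_zero.1 (ha.2 ▸ hab i)⟩⟩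
    have hle : D₁ ≤ D := fun y hy => D.lower le_self_add hy
    have hD₁ : ∀ y ∈ D₁, ∀ j ∉ insert i t, y j = 0 := fun y hy => hD y (hle hy)
    have hD₀ : EventuallyQuasiPoly fun n => ({y | y ∈ D₀ ∧ deg y = n}.ncard : ℤ) := by
      refine ih (fun j hj => ht j (by simp [hj])) D₀ fun y hy j hj => ?_
      by_cases hji : j = i
      · exact hji ▸ hy.2
      · exact hD y hy.1 j (by simp [hji, hj])
    have hrec : ∀ n, ({y | y ∈ D ∧ deg y = n + deg (Pi.single i 1)}.ncard : ℤ) =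
        ({y | y ∈ D₁ ∧ deg y = n}.ncard : ℤ) +
          ({y | y ∈ D₀ ∧ deg y = n + deg (Pi.single i 1)}.ncard : ℤ) := by
      intro n
      have hun : {y | y ∈ D ∧ deg y = n + deg (Pi.single i 1)} =
          (fun y => y + Pi.single i 1) '' {y | y ∈ D₁ ∧ deg y = n} ∪
            {y | y ∈ D₀ ∧ deg y = n + deg (Pi.single i 1)} := by
        ext y
        constructor
        · rintro ⟨hy, hd⟩
          rcases Nat.eq_zero_or_pos (y i) with h0 | h0
          · exact Or.inr ⟨⟨hy, h0⟩, hd⟩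
          · have hs : Pi.single i 1 ≤ y := by
              intro j
              by_cases hj : j = i
              · subst hj; simpa [Nat.one_le_iff_ne_zero] using h0.ne'
              · simp [hj]
            have hy' : y - Pi.single i 1 + Pi.single i 1 = y := tsub_add_cancel_of_le hs
            refine Or.inl ⟨y - Pi.single i 1, ⟨?_, ?_⟩, hy'⟩
            · change y - Pi.single i 1 + Pi.single i 1 ∈ D
              rwa [hy']
            · rw [← hy', map_add] at hd
              exact Nat.add_right_cancel hd
        · rintro (⟨z, ⟨hz, rfl⟩, rfl⟩ | ⟨hz, hd⟩)
          · exact ⟨hz, map_add _ _ _⟩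
          · exact ⟨hz.1, hd⟩
      rw [hun, Set.ncard_union_eq ?_ ((finite_setOf_degree_eq deg D₁ (hsupp _ hD₁) n).image _)
          (finite_setOf_degree_eq deg D₀ (hsupp _ fun y hy => hD y hy.1) _),
        Set.ncard_image_of_injective _ (add_left_injective _),
        Nat.cast_add]
      rw [Set.disjoint_left]
      rintro _ ⟨z, -, rfl⟩ ⟨hz, -⟩
      have := hz.2
      simp at this
    -- A strictly smaller `D₁` falls to well-founded induction; if `D₁ = D`, the count satisfies a
    -- recurrence with step `w`.
    rcases hle.lt_or_eq with hlt | heq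
    · refine EventuallyQuasiPoly.of_shift (d := deg (Pi.single i 1)) ?_
      simp only [hrec]
      exact (ihD D₁ hlt hD₁).add (hD₀.shift _)
    · simp only [heq] at hrec
      exact EventuallyQuasiPoly.of_recurrence hw (hD₀.shift _) hrec

theorem eventuallyQuasiPoly_lowerSet [Finite ι] (D : LowerSet (ι → ℕ))
    (hD : ∀ y ∈ D, ∀ i, deg (Pi.single i 1) = 0 → y i = 0) :
    EventuallyQuasiPoly fun n => ({y | y ∈ D ∧ deg y = n}.ncard : ℤ) := by
  classical
  have := Fintype.ofFinite ι
  refine eventuallyQuasiPoly_lowerSet_of_support deg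
    (Finset.univ.filter fun i => 0 < deg (Pi.single i 1)) (by simp) D fun y hy i hi => ?_
  exact hD y hy i (by simpa using hi)

end LowerSet

/-! ### Sets stable under a subtractive monoid -/

section Monoid

variable {M : Type*} [AddCommMonoid M] [PartialOrder M] [WellQuasiOrderedLE M]
  [IsOrderedCancelAddMonoid M] [CanonicallyOrderedAdd M]

/-- Let `S` be stable under translation by a subtractive submonoid `H` which contains the
differences of comparable elements of `S`. Then the number of elements of `S` of given degree is
eventually quasi-polynomial. -/
theorem eventuallyQuasiPoly_of_subtractive (H : AddSubmonoid M) (S : Set M) (deg : M →+ ℕ)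
    (hH : ∀ x ∈ H, ∀ y, x + y ∈ H → y ∈ H) (hHS : ∀ x ∈ S, ∀ h ∈ H, x + h ∈ S)
    (hSH : ∀ x ∈ S, ∀ y, x + y ∈ S → y ∈ H) (hdeg : ∀ h ∈ H, deg h = 0 → h = 0)
    (hfin : ∀ n, {x | x ∈ S ∧ deg x = n}.Finite) :
    EventuallyQuasiPoly fun n => ({x | x ∈ S ∧ deg x = n}.ncard : ℤ) := by
  classical
  rcases S.eq_empty_or_nonempty with rfl | hS
  · simpa using EventuallyQuasiPoly.const 0
  obtain ⟨k, f, hf⟩ := AddSubmonoid.fg_iff_exists_fin_addMonoidHom.1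
    (AddSubmonoid.fg_of_subtractive hH)
  have hfH : ∀ y, f y ∈ H := fun y => hf ▸ ⟨y, rfl⟩
  have hpwo := Set.isPWO_of_wellQuasiOrderedLE S
  obtain ⟨r, e, he⟩ := ((setOfPred_minimal_antichain (· ∈ S)).finite_of_partiallyWellOrderedOn
    (hpwo.mono (setOfPred_minimal_subset _))).fin_embedding
  have heS : ∀ i, e i ∈ S := fun i => by
    have : e i ∈ Set.range e := ⟨i, rfl⟩
    rw [he] at this
    exact this.1
  -- The `e i` are the minimal elements of `S`, so `Φ` parametrizes `S` redundantly. The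
  -- lexicographic order is well-founded and translation-invariant in the second component.
  let Φ : Fin r ×ₗ Lex (Fin k → ℕ) → M := fun q => e (ofLex q).1 + f (ofLex (ofLex q).2)
  let pt : Fin r → (Fin k → ℕ) → Fin r ×ₗ Lex (Fin k → ℕ) := fun i y => toLex (i, toLex y)
  have hΦS : ∀ q, Φ q ∈ S := fun q => hHS _ (heS _) _ (hfH _)
  have hsurj : ∀ x ∈ S, ∃ q, Φ q = x := by
    intro x hx
    obtain ⟨z, hz, hz'⟩ := hpwo.exists_le_minimal hx
    obtain ⟨h, rfl⟩ := exists_add_of_le hz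
    have hzr : z ∈ Set.range e := by rw [he]; exact hz'
    obtain ⟨i, rfl⟩ := hzr
    have hh : h ∈ H := hSH _ (heS i) _ hx
    rw [← hf] at hh
    obtain ⟨y, rfl⟩ := hh
    exact ⟨pt i y, rfl⟩
  have hlt : ∀ i j y z d, pt i y < pt j z → pt i (y + d) < pt j (z + d) := by
    intro i j y z d h
    rw [Prod.Lex.toLex_lt_toLex] at h ⊢
    refine h.imp_right (And.imp_right fun h => ?_)
    obtain ⟨l, hl, hl'⟩ := h
    exact ⟨l, fun m hm => congrArg (· + d m) (hl m hm), Nat.add_lt_add_right hl' (d l)⟩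
  -- Least representations form a lower set: a smaller representation of `Φ (pt i y)`, translated by
  -- `d`, is a smaller one of `Φ (pt i (y + d))`.
  let R : Fin r → LowerSet (Fin k → ℕ) := fun i =>
    ⟨{y | ∀ q < pt i y, Φ q ≠ Φ (pt i y)}, fun z y hyz hz q hq hΦ => by
      obtain ⟨d, rfl⟩ := exists_add_of_le hyz
      refine hz (pt (ofLex q).1 (ofLex (ofLex q).2 + d)) (hlt _ _ _ _ d hq) ?_
      change e _ + f (ofLex (ofLex q).2 + d) = e i + f (y + d)
      rw [map_add, map_add, ← add_assoc, ← add_assoc]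
      exact congrArg (· + f d) hΦ⟩
  -- A generator of degree zero is `0`, so dropping it would give a smaller representation.
  have hRzero : ∀ i, ∀ y ∈ R i, ∀ j, deg.comp f (Pi.single j 1) = 0 → y j = 0 := by
    intro i y hy j hj
    by_contra hne
    have hfj : f (Pi.single j 1) = 0 := hdeg _ (hfH _) hj
    have hs : Pi.single j 1 ≤ y := by
      intro l
      by_cases hl : l = j
      · subst hl; simpa [Nat.one_le_iff_ne_zero] using hne
      · simp [hl]
    obtain ⟨d, rfl⟩ := exists_add_of_le hs
    refine hy (pt i d) ?_ ?_
    · rw [Prod.Lex.toLex_lt_toLex]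
      refine Or.inr ⟨rfl, Pi.toLex_strictMono ?_⟩
      refine lt_add_of_pos_left _ (lt_of_le_of_ne zero_le fun h => ?_)
      simpa using congrFun h j
    · change e i + f d = e i + f (Pi.single j 1 + d)
      rw [map_add, hfj, zero_add]
  have hrep : ∀ x ∈ S, ∃ q, Φ q = x ∧ ∀ q' < q, Φ q' ≠ x := by
    intro x hx
    obtain ⟨q, hq, hmin⟩ := WellFounded.has_min (wellFounded_lt (α := Fin r ×ₗ Lex (Fin k → ℕ)))
      {q | Φ q = x} (hsurj x hx)
    exact ⟨q, hq, fun q' hq' h => hmin q' h hq'⟩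
  have : Nonempty (Fin r ×ₗ Lex (Fin k → ℕ)) := hS.elim fun x hx => ⟨(hsurj x hx).choose⟩
  choose! rep hrepΦ hrepmin using hrep
  have huniq : ∀ i, ∀ y ∈ R i, rep (Φ (pt i y)) = pt i y := by
    intro i y hy
    have hS := hΦS (pt i y)
    rcases lt_trichotomy (rep (Φ (pt i y))) (pt i y) with h | h | h
    · exact absurd (hrepΦ _ hS) (hy _ h)
    · exact h
    · exact absurd rfl (hrepmin _ hS _ h)
  have hcount : ∀ n, ({x | x ∈ S ∧ deg x = n}.ncard : ℤ) =
      ∑ i, ({y | y ∈ R i ∧ deg.comp f y + deg (e i) = n}.ncard : ℤ) := by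
    intro n
    rw [ncard_eq_sum_ncard_fiber (hfin n) (fun x => (ofLex (rep x)).1) Finset.univ (by simp),
      Nat.cast_sum]
    refine Finset.sum_congr rfl fun i _ => ?_
    have himg : {x | x ∈ {x | x ∈ S ∧ deg x = n} ∧ (ofLex (rep x)).1 = i} =
        (fun y => Φ (pt i y)) '' {y | y ∈ R i ∧ deg.comp f y + deg (e i) = n} := by
      ext x
      constructor
      · rintro ⟨⟨hx, rfl⟩, rfl⟩
        refine ⟨ofLex (ofLex (rep x)).2, ⟨?_, ?_⟩, hrepΦ x hx⟩
        · intro q hq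
          have := hrepmin x hx q hq
          rwa [← hrepΦ x hx] at this
        · conv_rhs => rw [← hrepΦ x hx]
          exact (add_comm _ _).trans (map_add deg _ _).symm
      · rintro ⟨y, ⟨hy, rfl⟩, rfl⟩
        refine ⟨⟨hΦS _, ?_⟩, ?_⟩
        · exact (map_add deg _ _).trans (add_comm _ _)
        · rw [huniq i y hy]
          rfl
    rw [himg, Set.InjOn.ncard_image]
    rintro y ⟨hy, -⟩ z ⟨hz, -⟩ h
    have h' := congrArg rep h
    dsimp only at h'
    rw [huniq i y hy, huniq i z hz] at h'
    exact toLex.injective (Prod.ext_iff.1 (toLex.injective h')).2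
  simp only [hcount]
  refine EventuallyQuasiPoly.sum _ fun i _ => ?_
  refine EventuallyQuasiPoly.of_shift (d := deg (e i)) ?_
  simp only [Nat.add_right_cancel_iff]
  exact eventuallyQuasiPoly_lowerSet (deg.comp f) (R i) (hRzero i)

end Monoid

/-! ### Lattice points in boxes, and carries -/

/-- The points of the box `[0, n)^ι` that satisfy the equations `α · x = u n + w` for all
`(α, u, w) ∈ E`. -/
def boxSolutions {ι : Type*} [Fintype ι] (E : Set ((ι → ℤ) × ℤ × ℤ)) (n : ℕ) : Set (ι → ℕ) :=
  {x | (∀ q, x q < n) ∧ ∀ e ∈ E, ∑ q, e.1 q * (x q : ℤ) = e.2.1 * n + e.2.2}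

theorem finite_boxSolutions {ι : Type*} [Fintype ι] (E : Set ((ι → ℤ) × ℤ × ℤ)) (n : ℕ) :
    (boxSolutions E n).Finite :=
  (Set.Finite.pi' fun _ : ι => Set.finite_Iio n).subset fun _ hx => hx.1

theorem eventuallyQuasiPoly_boxSolutions {ι : Type*} [Fintype ι] (E : Set ((ι → ℤ) × ℤ × ℤ)) :
    EventuallyQuasiPoly fun n => ((boxSolutions E n).ncard : ℤ) := by
  -- Triples `(n, x, slack)`. The slack turns the bound on `x` into an equation, and the `+ 1` in
  -- `S` makes it strict.
  let H : AddSubmonoid (ℕ × (ι → ℕ) × (ι → ℕ)) :=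
    { carrier := {z | (∀ q, z.2.1 q + z.2.2 q = z.1) ∧
        ∀ e ∈ E, ∑ q, e.1 q * (z.2.1 q : ℤ) = e.2.1 * z.1}
      zero_mem' := by simp
      add_mem' := by
        rintro a b ⟨ha, ha'⟩ ⟨hb, hb'⟩
        refine ⟨fun q => ?_, fun e he => ?_⟩
        · simp only [Prod.fst_add, Prod.snd_add, Pi.add_apply, ← ha q, ← hb q]
          ring
        · simp only [Prod.fst_add, Prod.snd_add, Pi.add_apply, Nat.cast_add, mul_add,
            Finset.sum_add_distrib, ha' e he, hb' e he] }
  let S : Set (ℕ × (ι → ℕ) × (ι → ℕ)) := {z | (∀ q, z.2.1 q + z.2.2 q + 1 = z.1) ∧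
    ∀ e ∈ E, ∑ q, e.1 q * (z.2.1 q : ℤ) = e.2.1 * z.1 + e.2.2}
  have himg : ∀ n, boxSolutions E n =
      (fun z : ℕ × (ι → ℕ) × (ι → ℕ) => z.2.1) '' {z | z ∈ S ∧ z.1 = n} := by
    intro n
    ext x
    constructor
    · rintro ⟨hx, hx'⟩
      refine ⟨(n, x, fun q => n - 1 - x q), ⟨⟨fun q => ?_, hx'⟩, rfl⟩, rfl⟩
      have := hx q
      dsimp only
      omega
    · rintro ⟨z, ⟨⟨h1, h2⟩, rfl⟩, rfl⟩
      refine ⟨fun q => ?_, h2⟩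
      have := h1 q
      dsimp only
      omega
  have hinj : ∀ n, Set.InjOn (fun z : ℕ × (ι → ℕ) × (ι → ℕ) => z.2.1) {z | z ∈ S ∧ z.1 = n} := by
    rintro n ⟨a, x, y⟩ ⟨⟨h1, -⟩, rfl⟩ ⟨a', x', y'⟩ ⟨⟨h1', -⟩, h⟩ hxx
    dsimp only at h h1 h1' hxx
    subst h hxx
    refine Prod.ext rfl (Prod.ext rfl (funext fun q => ?_))
    have := h1 q
    have := h1' q
    dsimp only
    omega
  have hmain := eventuallyQuasiPoly_of_subtractive H S (AddMonoidHom.fst _ _) ?_ ?_ ?_ ?_ ?_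
  · refine hmain.congr (Eventually.of_forall fun n => ?_)
    dsimp only
    rw [himg n, (hinj n).ncard_image]
    rfl
  · rintro a ⟨ha, ha'⟩ b ⟨hb, hb'⟩
    simp only [Prod.fst_add, Prod.snd_add, Pi.add_apply, Nat.cast_add, mul_add,
      Finset.sum_add_distrib] at hb hb'
    refine ⟨fun q => ?_, fun e he => ?_⟩
    · have := ha q
      have := hb q
      omega
    · have := ha' e he
      have := hb' e he
      linarith
  · rintro a ⟨ha, ha'⟩ b ⟨hb, hb'⟩
    refine ⟨fun q => ?_, fun e he => ?_⟩
    · have := ha q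
      have := hb q
      simp only [Prod.fst_add, Prod.snd_add, Pi.add_apply]
      omega
    · have := ha' e he
      have := hb' e he
      simp only [Prod.fst_add, Prod.snd_add, Pi.add_apply, Nat.cast_add, mul_add,
        Finset.sum_add_distrib]
      linarith
  · rintro a ⟨ha, ha'⟩ b ⟨hb, hb'⟩
    simp only [Prod.fst_add, Prod.snd_add, Pi.add_apply, Nat.cast_add, mul_add,
      Finset.sum_add_distrib] at hb hb'
    refine ⟨fun q => ?_, fun e he => ?_⟩
    · have := ha q
      have := hb q
      omega
    · have := ha' e he
      have := hb' e he
      linarith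
  · rintro ⟨a, x, y⟩ ⟨h, -⟩ (h0 : a = 0)
    subst h0
    dsimp only at h
    refine Prod.ext rfl (Prod.ext (funext fun q => ?_) (funext fun q => ?_))
    · exact Nat.eq_zero_of_add_eq_zero_right (h q)
    · exact Nat.eq_zero_of_add_eq_zero_left (h q)
  · intro n
    exact Set.Finite.of_finite_image ((himg n) ▸ finite_boxSolutions E n) (hinj n)

/-- Counting the points `x` of a box `[0, n)^ι` at which a polynomial in `n` with coefficients
affine in `x` vanishes, by splitting according to the carry out of the lowest digit. -/
theorem eventuallyQuasiPoly_carry {ι : Type*} [Fintype ι] (D : ℕ) (E : Set ((ι → ℤ) × ℤ × ℤ))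
    (α : ℕ → ι → ℤ) (β : ℕ → ℤ) (c : ℤ) :
    EventuallyQuasiPoly fun n => ({x | x ∈ boxSolutions E n ∧
      ∑ l ∈ Finset.range D, (∑ q, α l q * (x q : ℤ) + β l) * (n : ℤ) ^ l + c = 0}.ncard : ℤ) := by
  induction D generalizing E α β c with
  | zero =>
    by_cases hc : c = 0
    · simpa [hc] using eventuallyQuasiPoly_boxSolutions E
    · simpa [hc] using EventuallyQuasiPoly.const 0
  | succ D ih =>
    -- For `n ≥ 1` and digits below `n`, the lowest coefficient plus `c` is at most `n B` in
    -- absolute value, so the carry lies in `[-B, B]`.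
    let B : ℤ := ∑ q, |α 0 q| + |β 0| + |c|
    let carry : ℕ → (ι → ℕ) → ℤ := fun n x =>
      -∑ l ∈ Finset.range D, (∑ q, α (l + 1) q * (x q : ℤ) + β (l + 1)) * (n : ℤ) ^ l
    have hsplit : ∀ (n : ℕ) (x : ι → ℕ), ∑ l ∈ Finset.range (D + 1),
        (∑ q, α l q * (x q : ℤ) + β l) * (n : ℤ) ^ l + c =
          (∑ q, α 0 q * (x q : ℤ) + β 0 + c) - n * carry n x := by
      intro n x
      simp only [Finset.sum_range_succ', carry, mul_neg, Finset.mul_sum, sub_neg_eq_add, pow_zero,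
        mul_one]
      rw [Finset.sum_congr rfl fun l _ => show _ = (n : ℤ) *
        ((∑ q, α (l + 1) q * (x q : ℤ) + β (l + 1)) * (n : ℤ) ^ l) by ring]
      ring
    -- Fixing the carry `γ` adds the equation `α₀ · x = γ n - β₀ - c`, and `γ` becomes the incoming
    -- constant for the remaining powers.
    refine (EventuallyQuasiPoly.sum (Finset.Icc (-B) B) fun γ _ =>
      ih (insert (α 0, γ, -β 0 - c) E) (fun l => α (l + 1)) (fun l => β (l + 1)) γ).congr ?_
    filter_upwards [eventually_gt_atTop 0] with n hn
    rw [ncard_eq_sum_ncard_fiber ((finite_boxSolutions E n).subset fun x hx => hx.1) (carry n)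
      (Finset.Icc (-B) B), Nat.cast_sum]
    · refine Finset.sum_congr rfl fun γ _ => ?_
      congr 2
      ext x
      simp only [Set.mem_ofPred_eq, hsplit, boxSolutions, Set.forall_mem_insert]
      constructor
      · rintro ⟨⟨hx, h0, hE⟩, hγ⟩
        have hc : carry n x = γ := by simp only [carry]; linarith
        refine ⟨⟨⟨hx, hE⟩, ?_⟩, hc⟩
        rw [hc, h0]
        ring
      · rintro ⟨⟨⟨hx, hE⟩, h0⟩, hγ⟩
        refine ⟨⟨hx, ?_, hE⟩, ?_⟩
        · rw [hγ] at h0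
          linarith
        · simp only [carry] at hγ
          linarith
    · rintro x ⟨hx, h0⟩
      rw [hsplit] at h0
      have hn' : (0 : ℤ) < n := by exact_mod_cast hn
      have hn1 : (1 : ℤ) ≤ n := hn'
      have hx1 : |∑ q, α 0 q * (x q : ℤ)| ≤ (∑ q, |α 0 q|) * n := by
        rw [Finset.sum_mul]
        refine (Finset.abs_sum_le_sum_abs _ _).trans (Finset.sum_le_sum fun q _ => ?_)
        rw [abs_mul, Nat.abs_cast]
        exact mul_le_mul_of_nonneg_left (by exact_mod_cast (hx.1 q).le) (abs_nonneg _)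
      have hx2 : |(n : ℤ) * carry n x| ≤ n * B := by
        rw [← sub_eq_zero.1 h0]
        calc _ ≤ |∑ q, α 0 q * (x q : ℤ)| + |β 0| + |c| :=
              (abs_add_le _ _).trans (add_le_add_left (abs_add_le _ _) _)
          _ ≤ (∑ q, |α 0 q|) * n + |β 0| * n + |c| * n := by
              gcongr
              · exact le_mul_of_one_le_right (abs_nonneg _) hn1
              · exact le_mul_of_one_le_right (abs_nonneg _) hn1
          _ = n * B := by simp only [B]; ring
      rw [abs_mul, Nat.abs_cast] at hx2
      exact Finset.mem_Icc.2 (abs_le.1 (le_of_mul_le_mul_left hx2 hn'))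

/-! ### Digits in base `n` and the equation -/

theorem eventually_eval_pos_of_rat {p : ℚ[X]} (hp : 0 < p.leadingCoeff) :
    ∀ᶠ n : ℕ in atTop, 0 < p.eval (n : ℚ) := by
  refine tendsto_natCast_atTop_atTop.eventually (p := fun x : ℚ => 0 < p.eval x) ?_
  by_cases hd : 0 < p.degree
  · exact (tendsto_atTop_of_leadingCoeff_nonneg _ hd hp.le).eventually_gt_atTop 0
  · refine Eventually.of_forall fun x => ?_
    rw [eq_C_of_degree_le_zero (not_lt.1 hd)] at hp ⊢
    simpa using hp

theorem eventually_eval_pos {p : ℤ[X]} (hp : 0 < p.leadingCoeff) :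
    ∀ᶠ n : ℕ in atTop, 0 < p.eval (n : ℤ) := by
  have hq : 0 < (p.map (Int.castRingHom ℚ)).leadingCoeff := by
    rw [leadingCoeff_map_of_injective (RingHom.injective_int _)]
    simpa using hp
  filter_upwards [eventually_eval_pos_of_rat hq] with n hn
  rw [← Int.cast_natCast, eval_intCast_map] at hn
  simpa using hn

theorem leadingCoeff_pos_of_eventually {p : ℤ[X]}
    (hp : ∀ᶠ n : ℕ in atTop, 0 < p.eval (n : ℤ)) : 0 < p.leadingCoeff := by
  rcases lt_trichotomy p.leadingCoeff 0 with h | h | h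
  · have h' : 0 < (-p).leadingCoeff := by rw [leadingCoeff_neg]; linarith
    obtain ⟨n, h1, h2⟩ := (hp.and (eventually_eval_pos h')).exists
    rw [eval_neg] at h2
    linarith
  · obtain ⟨n, hn⟩ := hp.exists
    simp [leadingCoeff_eq_zero.1 h] at hn
  · exact h

theorem eventually_eval_lt_pow (p : ℤ[X]) :
    ∀ᶠ n : ℕ in atTop, p.eval (n : ℤ) < (n : ℤ) ^ (p.natDegree + 1) := by
  have hd : p.degree < (X ^ (p.natDegree + 1) : ℤ[X]).degree := by
    rw [degree_X_pow]
    exact degree_le_natDegree.trans_lt (by exact_mod_cast Nat.lt_succ_self _)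
  have hl : 0 < (X ^ (p.natDegree + 1) - p).leadingCoeff := by
    rw [leadingCoeff_sub_of_degree_lt hd]
    simp
  filter_upwards [eventually_eval_pos hl] with n hn
  simpa using hn

theorem finite_solutions {s : ℕ} {a : Fin s → ℤ} (ha : ∀ i, 0 < a i) (m : ℤ) :
    (solutions a m).Finite ∧ ∀ x ∈ solutions a m, ∀ i, (x i : ℤ) ≤ m := by
  have hle : ∀ x ∈ solutions a m, ∀ i, (x i : ℤ) ≤ m := by
    intro x hx i
    calc (x i : ℤ) ≤ a i * x i := le_mul_of_one_le_left (by positivity) (ha i)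
      _ ≤ ∑ j, a j * (x j : ℤ) := Finset.single_le_sum (f := fun j => a j * (x j : ℤ))
          (fun j _ => mul_nonneg (ha j).le (by positivity)) (Finset.mem_univ i)
      _ = m := hx
  refine ⟨(Set.Finite.pi' fun _ : Fin s => Set.finite_Iic m.toNat).subset fun x hx i => ?_, hle⟩
  have := hle x hx i
  simp only [Set.mem_Iic]
  omega

/-- The number of solutions, for integer polynomial data, counted by base `n` digits. -/
theorem eventuallyQuasiPoly_solutions_polynomial {s : ℕ} (m : ℤ[X]) (a : Fin s → ℤ[X])
    (ha : ∀ i, 0 < (a i).leadingCoeff) :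
    EventuallyQuasiPoly fun n =>
      ((solutions (fun i => (a i).eval (n : ℤ)) (m.eval (n : ℤ))).ncard : ℤ) := by
  let K := m.natDegree + 1
  let P : (Fin s × Fin K → ℕ) → ℤ[X] := fun x =>
    ∑ q : Fin s × Fin K, C (x q : ℤ) * (a q.1 * X ^ (q.2 : ℕ)) - m
  -- A crude bound above the degree of every `P x`, uniform in the digits.
  let D := (∑ i, (a i).natDegree) + m.natDegree + K + 1
  have hdeg : ∀ x, (P x).natDegree < D := by
    intro x
    refine Nat.lt_succ_of_le ((natDegree_sub_le _ _).trans (max_le ?_ (by omega)))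
    refine natDegree_sum_le_of_forall_le _ _ fun q _ => ?_
    have h1 : (a q.1).natDegree ≤ ∑ i, (a i).natDegree :=
      Finset.single_le_sum (f := fun i => (a i).natDegree) (by simp) (Finset.mem_univ _)
    have h2 := (natDegree_C_mul_le (x q : ℤ) (a q.1 * X ^ (q.2 : ℕ))).trans natDegree_mul_le
    rw [natDegree_X_pow] at h2
    have := q.2.2
    omega
  have hPeval : ∀ (n : ℕ) (x : Fin s × Fin K → ℕ), ∑ l ∈ Finset.range D,
      (∑ q : Fin s × Fin K, (a q.1 * X ^ (q.2 : ℕ)).coeff l * (x q : ℤ) + -m.coeff l) *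
        (n : ℤ) ^ l + 0 = (∑ i, (a i).eval (n : ℤ) *
          ((∑ j : Fin K, x (i, j) * n ^ (j : ℕ) : ℕ) : ℤ)) - m.eval (n : ℤ) := by
    intro n x
    have h1 : (P x).eval (n : ℤ) = (∑ i, (a i).eval (n : ℤ) *
          ((∑ j : Fin K, x (i, j) * n ^ (j : ℕ) : ℕ) : ℤ)) - m.eval (n : ℤ) := by
      simp only [P, eval_sub, eval_finsetSum, eval_mul, eval_C, eval_pow, eval_X,
        Fintype.sum_prod_type, Nat.cast_sum, Nat.cast_mul, Nat.cast_pow, Finset.mul_sum]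
      congr 1
      refine Finset.sum_congr rfl fun i _ => Finset.sum_congr rfl fun j _ => ?_
      ring
    rw [← h1, eval_eq_sum_range' (hdeg x), add_zero]
    refine Finset.sum_congr rfl fun l _ => ?_
    simp only [P, coeff_sub, finsetSum_coeff, coeff_C_mul]
    rw [← sub_eq_add_neg]
    simp only [mul_comm]
  refine (eventuallyQuasiPoly_carry D ∅
    (fun l (q : Fin s × Fin K) => (a q.1 * X ^ (q.2 : ℕ)).coeff l) (fun l => -m.coeff l) 0).congr ?_
  filter_upwards [eventually_all.2 fun i => eventually_eval_pos (ha i),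
    eventually_eval_lt_pow m] with n han hmn
  congr 1
  simp only [hPeval, sub_eq_zero, boxSolutions, Set.mem_empty_iff_false, false_imp_iff,
    implies_true, and_true]
  -- `finFunctionFinEquiv` is the base `n` expansion: injectivity gives unique digits, its inverse
  -- supplies them.
  have hdig : ∀ z : Fin K → Fin n,
      ((finFunctionFinEquiv z : Fin (n ^ K)) : ℕ) = ∑ j, (z j : ℕ) * n ^ (j : ℕ) :=
    finFunctionFinEquiv_apply
  refine Set.ncard_congr (fun x _ i => ∑ j : Fin K, x (i, j) * n ^ (j : ℕ)) ?_ ?_ ?_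
  · rintro x ⟨-, hx⟩
    exact hx
  · rintro x y ⟨hx, -⟩ ⟨hy, -⟩ hxy
    ext ⟨i, j⟩
    have h := congrFun hxy i
    have h' : (finFunctionFinEquiv fun j => (⟨x (i, j), hx (i, j)⟩ : Fin n)) =
        finFunctionFinEquiv fun j => (⟨y (i, j), hy (i, j)⟩ : Fin n) := by
      rw [Fin.ext_iff, hdig, hdig]
      exact h
    exact congrArg Fin.val (congrFun (finFunctionFinEquiv.injective h') j)
  · intro y hy
    have hlt : ∀ i, y i < n ^ K := fun i => by
      exact_mod_cast ((finite_solutions han _).2 y hy i).trans_lt hmn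
    have hdig' : ∀ i, ∑ j : Fin K,
        (finFunctionFinEquiv.symm (⟨y i, hlt i⟩ : Fin (n ^ K)) j : ℕ) * n ^ (j : ℕ) = y i := by
      intro i
      rw [← hdig, Equiv.apply_symm_apply]
    refine ⟨fun q => finFunctionFinEquiv.symm (⟨y q.1, hlt q.1⟩ : Fin (n ^ K)) q.2,
      ⟨fun q => Fin.is_lt _, ?_⟩, funext hdig'⟩
    simp only [hdig']
    exact hy

theorem IsPosIntValuedPoly.eventuallyPoly {f : ℕ → ℤ} (hf : IsPosIntValuedPoly f) :
    EventuallyPoly f := by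
  obtain ⟨p, -, hp⟩ := hf
  exact ⟨p, Eventually.of_forall hp⟩

theorem IsPosIntValuedPoly.eventually_pos {f : ℕ → ℤ} (hf : IsPosIntValuedPoly f) :
    ∀ᶠ n in atTop, 0 < f n := by
  obtain ⟨p, hp, hf⟩ := hf
  filter_upwards [eventually_eval_pos_of_rat hp] with n hn
  rw [← hf] at hn
  exact_mod_cast hn

/-- The number of nonnegative solutions of `a₁(n) x₁ + ⋯ + aₛ(n) xₛ = m(n)` is eventually
quasi-polynomial in `n`. -/
theorem eventuallyQuasiPoly_solutions {s : ℕ} {m : ℕ → ℤ} {a : Fin s → ℕ → ℤ}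
    (hm : EventuallyPoly m) (ha : ∀ i, IsPosIntValuedPoly (a i)) :
    EventuallyQuasiPoly fun n => ((solutions (fun i => a i n) (m n)).ncard : ℤ) := by
  have hall : ∀ k : Option (Fin s), EventuallyPoly (k.elim m a) := by
    rintro (_ | i)
    · exact hm
    · exact (ha i).eventuallyPoly
  obtain ⟨D, hD, hR⟩ := exists_common_period hall
  refine EventuallyQuasiPoly.of_residues hD fun j => ?_
  choose R hR using fun k => hR k j
  refine (eventuallyQuasiPoly_solutions_polynomial (R none) (fun i => R (some i)) fun i => ?_).congr
    ?_
  -- The sign of the leading coefficient is recovered from the values of `a i` along the class.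
  · apply leadingCoeff_pos_of_eventually
    filter_upwards [hR (some i), (tendsto_mul_add hD j).eventually (ha i).eventually_pos]
      with n h1 h2
    rw [← h1]
    exact h2
  · filter_upwards [eventually_all.2 hR] with n hn
    simp only [← hn]
    rfl

end QuasiPoly

theorem theorem1p1 (s : ℕ) (m : ℕ → ℤ) (a : Fin s → ℕ → ℤ)
    (hm : QuasiPoly.IsPosIntValuedPoly m)
    (ha : ∀ i, QuasiPoly.IsPosIntValuedPoly (a i))
    (hcop : QuasiPoly.StronglyCoprime a) :
    ∃ f : ℕ → ℤ, QuasiPoly.IsQuasiPoly f ∧ ∃ N : ℕ, ∀ n : ℕ, N ≤ n →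
      (QuasiPoly.solutions (fun i => a i n) (m n)).Finite ∧
      ((QuasiPoly.solutions (fun i => a i n) (m n)).ncard : ℤ) = f n := by
  obtain ⟨f, hf, hfe⟩ :=
    (QuasiPoly.eventuallyQuasiPoly_solutions hm.eventuallyPoly ha).exists_isQuasiPoly
  refine ⟨f, hf, Filter.eventually_atTop.1 ?_⟩
  filter_upwards [hfe, Filter.eventually_all.2 fun i => (ha i).eventually_pos] with n h1 h2
  exact ⟨(QuasiPoly.finite_solutions h2 _).1, h1⟩
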